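/- A L\'evy exponent is a continuous function $f:\mathbb{R}\to\mathbb{C}$ with $f(0)=0$ such that $e^{f}$ is the characteristic function of an infinitely divisible probability law on $\mathbb{R}$. It has L\'evy triplet $(\mu,\sigma^2,V)$, where $\mu\in\mathbb{R}$, $\sigma^2\ge 0$ and $V$ is a measure on $\mathbb{R}$ with $V(\{0\})=0$ and $\int_{\mathbb{R}}\min(1,t^2)\,V(\mathrm{d}t)<\infty$, if $$f(\xi)=\mathrm{i}\mu\xi-\frac{\sigma^2\xi^2}{2}+\int_{\mathbb{R}}\bigl(e^{\mathrm{i}\xi t}-1-\mathrm{i}\xi t\,1_{|t|\le 1}\bigr)V(\mathrm{d}t)\qquad(\xi\in\mathbb{R}).$$ For $0\le p_{\min}\le p_{\max}\le 2$, the triplet $(\mu,\sigma^2,V)$ is a $(p_{\min},p_{\max})$-triplet, with witness $(p,q)$, if $p_{\min}\le p\le q\le p_{\max}$ and 1. $\int_{|t|\ge 1}|t|^{p}\,V(\mathrm{d}t)<\infty$; 2. $\int_{|t|<1}|t|^{q}\,V(\mathrm{d}t)<\infty$; 3. $p_{\min}=\min(p,1)$ if $V$ is not symmetric or $\mu\neq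 0$; 4. $p_{\max}=2$ if $\sigma^2\neq 0$. A L\'evy exponent is a $(p_{\min},p_{\max})$-exponent if it has a L\'evy triplet that is a $(p_{\min},p_{\max})$-triplet for some witness $(p,q)$. **Proposition.** Let $0\le p_{\min}\le p_{\max}\le 2$ and let $f$ be a $(p_{\min},p_{\max})$-exponent. Then, for every $\lambda>0$ and $\tau>0$, the function $$f_{\lambda,\tau}(\xi)=\lambda\bigl(e^{\tau f(\xi)}-1\bigr)$$ is again a $(p_{\min},p_{\max})$-exponent. More precisely, there is an infinitely divisible probability law $P$ on $\mathbb{R}$ with L\'evy exponent $\tau f$; the function $f_{\lambda,\tau}$ is the L\'evy exponent of the compound-Poisson law with rate $\lambda$ and jump law $P$; it has the L\'evy triplet $$\Bigl(\lambda\int_{|t|\le 1}t\,P(\mathrm{d}t),\ 0,\ \lambda P|_{\mathbb{R}\setminus\{0\}}\Bigr);$$ and every witness $(p,q)$ for the L\'evy triplet of $f$ is also a witness for this triplet. In particular, the L\'evy measure $\lambda P|_{\mathbb{R}\setminus\{0\}}$ satisfies the moment conditions 1 and 2 with the same $p$ and $q$. -/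

import Mathlib

open MeasureTheory
open scoped NNReal ENNReal

noncomputable section

namespace LevyExponents

/-- The law of `X₁ + ⋯ + Xₙ`, where the `Xᵢ` are i.i.d. with law `P`. For `n = 0` it is `δ₀`. -/
def iidSumLaw (P : Measure ℝ) (n : ℕ) : Measure ℝ :=
  (Measure.pi fun _ : Fin n => P).map fun x => ∑ i, x i

/-- Infinite divisibility of a law on `ℝ`: for every `n ≥ 1` it is the law of a sum of `n`
i.i.d. random variables. -/
def IsInfinitelyDivisible (P : Measure ℝ) : Prop :=
  ∀ n : ℕ, 1 ≤ n → ∃ R : Measure ℝ, IsProbabilityMeasure R ∧ iidSumLaw R n = P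

/-- `f` is the continuous log-characteristic function (the one vanishing at `0`) of the infinitely
divisible probability law `P`. -/
structure HasLevyExponent (P : Measure ℝ) (f : ℝ → ℂ) : Prop where
  isProbabilityMeasure : IsProbabilityMeasure P
  infinitelyDivisible : IsInfinitelyDivisible P
  continuous : Continuous f
  map_zero : f 0 = 0
  charFun_eq : ∀ ξ : ℝ, charFun P ξ = Complex.exp (f ξ)

/-- A Lévy exponent is the continuous log-characteristic function of an infinitely divisible
law. -/
def IsLevyExponent (f : ℝ → ℂ) : Prop :=
  ∃ P : Measure ℝ, HasLevyExponent P f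

/-- A Lévy measure on `ℝ`: no mass at `0`, and `∫ min (1, t²) V(dt) < ∞`. -/
structure IsLevyMeasure (V : Measure ℝ) : Prop where
  measure_zero : V {0} = 0
  lintegral_lt_top : ∫⁻ t, ENNReal.ofReal (min 1 (t ^ 2)) ∂V < ∞

/-- The Lévy-Khintchine function
`i μ ξ - σ² ξ² / 2 + ∫ (exp (i ξ t) - 1 - i ξ t 1_{|t| ≤ 1}) V(dt)`;
the argument `v` is the variance `σ²`. -/
def levyKhintchine (μ : ℝ) (v : ℝ≥0) (V : Measure ℝ) (ξ : ℝ) : ℂ :=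
  Complex.I * (μ * ξ : ℝ) - ((v : ℝ) * ξ ^ 2 / 2 : ℝ) +
    ∫ t, (Complex.exp (Complex.I * (ξ * t : ℝ)) - 1 -
      Complex.I * (ξ * Set.indicator {s : ℝ | |s| ≤ 1} id t : ℝ)) ∂V

/-- `f` is the Lévy exponent associated to the Lévy triplet `(μ, v, V)`, where `v = σ²`. -/
structure HasLevyTriplet (f : ℝ → ℂ) (μ : ℝ) (v : ℝ≥0) (V : Measure ℝ) : Prop where
  isLevyExponent : IsLevyExponent f
  isLevyMeasure : IsLevyMeasure V
  eq_levyKhintchine : ∀ ξ : ℝ, f ξ = levyKhintchine μ v V ξ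

/-- A measure on `ℝ` that is invariant under `t ↦ -t`. -/
def IsSymmetric (V : Measure ℝ) : Prop :=
  V.map (fun t => -t) = V

/-- The pair `(p, q)` witnesses that `(μ, v, V)`, with `v = σ²`, is a
`(pmin, pmax)`-triplet. -/
structure TripletWitness (pmin pmax p q : ℝ) (μ : ℝ) (v : ℝ≥0) (V : Measure ℝ) : Prop where
  pmin_le : pmin ≤ p
  le : p ≤ q
  le_pmax : q ≤ pmax
  large_jumps : ∫⁻ t in {t : ℝ | 1 ≤ |t|}, ENNReal.ofReal (|t| ^ p) ∂V < ∞
  small_jumps : ∫⁻ t in {t : ℝ | |t| < 1}, ENNReal.ofReal (|t| ^ q) ∂V < ∞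
  asymmetric : ¬ IsSymmetric V ∨ μ ≠ 0 → pmin = min p 1
  gaussian : v ≠ 0 → pmax = 2

/-- `f` is a `(pmin, pmax)`-exponent: the Lévy exponent of a `(pmin, pmax)`-triplet. -/
def IsExponent (pmin pmax : ℝ) (f : ℝ → ℂ) : Prop :=
  ∃ (μ : ℝ) (v : ℝ≥0) (V : Measure ℝ), HasLevyTriplet f μ v V ∧
    ∃ p q : ℝ, TripletWitness pmin pmax p q μ v V

/-- The compound-Poisson law of rate `r` and jump law `P`: the law of `X₁ + ⋯ + X_N`, where `N` is
a Poisson variable of parameter `r` that is independent of the i.i.d. variables `Xᵢ` of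
law `P`. -/
def compoundPoissonLaw (r : ℝ) (P : Measure ℝ) : Measure ℝ :=
  Measure.sum fun n : ℕ =>
    ENNReal.ofReal (Real.exp (-r) * r ^ n / n.factorial) • iidSumLaw P n

/-- The function `f_{r,τ}(ξ) = r (exp (τ f(ξ)) - 1)`. -/
def poissonExponent (r τ : ℝ) (f : ℝ → ℂ) (ξ : ℝ) : ℂ :=
  r * (Complex.exp (τ * f ξ) - 1)

/-- The Lévy measure `r P` restricted to `ℝ \ {0}` of a compound-Poisson law of rate `r` and jump
law `P` (jumps of size `0` are discarded). -/
def jumpMeasure (r : ℝ) (P : Measure ℝ) : Measure ℝ :=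
  ENNReal.ofReal r • P.restrict {0}ᶜ

end LevyExponents

end

/-!
Let `f` be a Lévy exponent and `R_n` the `n`-th root of the law with exponent `f`. Since `ℝ` is
connected, the characteristic function of `R_n` is `exp (f / n)` (`charFun_root_eq`), so that the
compound-Poisson law with rate `n τ` and jump law `R_n` has exponent `n τ (exp (f / n) - 1)`, which
converges to `τ f`. By tightness there is a limit law `P`, and its exponent is `τ f`
(`IsLevyExponent.exists_charFun_eq`). Applied to `τ / n`, the same construction gives the `n`-th
root of `P`. The exponent and the triplet of the compound-Poisson law with jump law `P` are then a
computation, because its Lévy measure is finite.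

The condition on the small jumps is trivial for a finite Lévy measure. Symmetry passes from `f` to
`P` because a symmetric triplet without drift has an even exponent. What remains is that `P` has a
finite `p`-th moment when the large jumps of `f` have one
(`HasLevyTriplet.lintegral_rpow_lt_top`). Let `Q` be the law of `X - X'`, where `X` and `X'` are
independent of law `P`. Its characteristic function is `exp (2 τ Re f)`, hence
`∫ (1 - cos (ξ t)) Q(dt) ≤ -2 τ Re f(ξ) = τ σ² ξ² + 2 τ ∫ (1 - cos (ξ t)) V(dt)`.
Nonnegative combinations over the frequencies `ξ = 2 ^ (-k)` of the functions `t ↦ 1 - cos (ξ t)`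
are comparable with `|t| ^ p` for `|t| ≥ 1` and are at most of the order of `t ^ 2` for `|t| < 1`
(`exists_dyadic_weights`). Integrating this inequality with such weights, followed by Fatou's
lemma, bounds the `p`-th moment of `Q` by `σ²`, the second moment of the small jumps and the `p`-th
moment of the large jumps; Fubini's theorem passes from `Q` to `P`
(`lintegral_rpow_lt_top_of_conv_neg`).
-/

open Filter Topology ProbabilityTheory

namespace LevyExponents

/-! ### Laws of i.i.d. sums and compound-Poisson laws -/

instance isProbabilityMeasure_iidSumLaw (P : Measure ℝ) [IsProbabilityMeasure P] (n : ℕ) :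
    IsProbabilityMeasure (iidSumLaw P n) :=
  Measure.isProbabilityMeasure_map (by fun_prop)

theorem charFun_iidSumLaw (P : Measure ℝ) [IsProbabilityMeasure P] (n : ℕ) (ξ : ℝ) :
    charFun (iidSumLaw P n) ξ = charFun P ξ ^ n := by
  rw [iidSumLaw, charFun_apply_real, integral_map (by fun_prop) (by fun_prop)]
  have h : ∀ x : Fin n → ℝ, Complex.exp (ξ * (∑ i, x i : ℝ) * Complex.I) =
      ∏ i, Complex.exp (ξ * (x i) * Complex.I) := fun x => by
    rw [← Complex.exp_sum, Complex.ofReal_sum, Finset.mul_sum, Finset.sum_mul]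
  simp_rw [h]
  rw [integral_fintype_prod_eq_pow (ι := Fin n) (fun t : ℝ => Complex.exp (ξ * t * Complex.I)),
    charFun_apply_real, Fintype.card_fin]

theorem hasSum_poissonWeights (r : ℝ) :
    HasSum (fun n : ℕ => Real.exp (-r) * r ^ n / n.factorial) 1 := by
  have h := (NormedSpace.expSeries_div_hasSum_exp (𝔸 := ℝ) r).mul_left (Real.exp (-r))
  rw [← Real.exp_eq_exp_ℝ, ← Real.exp_add, neg_add_cancel, Real.exp_zero] at h
  simpa only [mul_div_assoc] using h

theorem isProbabilityMeasure_compoundPoissonLaw {r : ℝ} (hr : 0 ≤ r) (P : Measure ℝ)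
    [IsProbabilityMeasure P] : IsProbabilityMeasure (compoundPoissonLaw r P) := by
  constructor
  have h := hasSum_poissonWeights r
  rw [compoundPoissonLaw, Measure.sum_apply _ MeasurableSet.univ]
  simp only [Measure.smul_apply, measure_univ, smul_eq_mul, mul_one]
  rw [← ENNReal.ofReal_tsum_of_nonneg (fun n => by positivity) h.summable, h.tsum_eq,
    ENNReal.ofReal_one]

theorem charFun_compoundPoissonLaw {r : ℝ} (hr : 0 ≤ r) (P : Measure ℝ) [IsProbabilityMeasure P]
    (ξ : ℝ) : charFun (compoundPoissonLaw r P) ξ = Complex.exp (r * (charFun P ξ - 1)) := by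
  have := isProbabilityMeasure_compoundPoissonLaw hr P
  have hint : Integrable (fun x : ℝ => Complex.exp (ξ * x * Complex.I))
      (compoundPoissonLaw r P) := by
    refine Integrable.of_bound (C := 1) (by fun_prop) (ae_of_all _ fun x => ?_)
    rw [← Complex.ofReal_mul, Complex.norm_exp_ofReal_mul_I]
  have h1 := hasSum_integral_measure hint
  have h2 : HasSum (fun n : ℕ => Complex.exp (-r) * ((r * charFun P ξ) ^ n / n.factorial))
      (Complex.exp (-r) * Complex.exp (r * charFun P ξ)) := by
    have h := (NormedSpace.expSeries_div_hasSum_exp (𝔸 := ℂ) (r * charFun P ξ)).mul_left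
      (Complex.exp (-r))
    rwa [← Complex.exp_eq_exp_ℂ] at h
  rw [← Complex.exp_add] at h2
  have h3 : (r : ℂ) * (charFun P ξ - 1) = -r + r * charFun P ξ := by ring
  have h4 : ∀ n : ℕ, ∫ x : ℝ, Complex.exp (ξ * x * Complex.I)
      ∂(ENNReal.ofReal (Real.exp (-r) * r ^ n / n.factorial) • iidSumLaw P n) =
      Complex.exp (-r) * ((r * charFun P ξ) ^ n / n.factorial) := fun n => by
    have hn : 0 ≤ Real.exp (-r) * r ^ n / n.factorial := by positivity
    rw [integral_smul_measure, ← charFun_apply_real, charFun_iidSumLaw, ENNReal.toReal_ofReal hn,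
      Complex.real_smul]
    push_cast
    ring
  simp_rw [h4] at h1
  rw [h3, charFun_apply_real]
  exact h1.unique h2

theorem iidSumLaw_eq_of_charFun_pow {P R : Measure ℝ} [IsProbabilityMeasure P]
    [IsProbabilityMeasure R] {n : ℕ} (h : ∀ ξ, charFun R ξ ^ n = charFun P ξ) :
    iidSumLaw R n = P :=
  Measure.ext_of_charFun (funext fun ξ => by rw [charFun_iidSumLaw, h])

/-! ### Positive multiples of Lévy exponents -/

/-- Existence half of the continuity theorem: by tightness a subsequence (here an ultrafilter)
converges weakly, and the limit has the limiting characteristic function. -/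
theorem exists_charFun_eq_of_tendsto {P : ℕ → Measure ℝ} [∀ n, IsProbabilityMeasure (P n)]
    {φ : ℝ → ℂ} (hφ : ContinuousAt φ 0)
    (h : ∀ ξ, Tendsto (fun n => charFun (P n) ξ) atTop (𝓝 (φ ξ))) :
    ∃ Q : Measure ℝ, IsProbabilityMeasure Q ∧ ∀ ξ, charFun Q ξ = φ ξ := by
  let ν : ℕ → ProbabilityMeasure ℝ := fun n => ⟨P n, inferInstance⟩
  have ht : IsTightMeasureSet {((μ : ProbabilityMeasure ℝ) : Measure ℝ) | μ ∈ Set.range ν} := by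
    convert isTightMeasureSet_of_tendsto_charFun hφ h using 1
    ext m
    exact ⟨fun ⟨_, ⟨n, hn⟩, hm⟩ => ⟨n, by rw [← hm, ← hn]; rfl⟩,
      fun ⟨n, hn⟩ => ⟨ν n, ⟨n, rfl⟩, hn⟩⟩
  obtain ⟨Q, -, hQ⟩ := (isCompact_closure_of_isTightMeasureSet ht).ultrafilter_le_nhds
    ((hyperfilter ℕ).map ν)
    (le_trans (by simp) (principal_mono.2 subset_closure))
  have hQ' : Tendsto ν (hyperfilter ℕ) (𝓝 Q) := hQ
  refine ⟨Q, inferInstance, fun ξ => ?_⟩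
  rw [ProbabilityMeasure.tendsto_iff_forall_integral_rclike_tendsto ℂ] at hQ'
  have h1 := hQ' (BoundedContinuousFunction.innerProbChar ξ)
  simp_rw [← charFun_eq_integral_innerProbChar] at h1
  exact tendsto_nhds_unique h1 ((h ξ).mono_left Nat.hyperfilter_le_atTop)

/-- The characteristic function of an `n`-th root of a law with exponent `f` is `exp (f / n)`:
the quotient of the two is a continuous function with values in the `n`-th roots of unity. -/
theorem charFun_root_eq {f : ℝ → ℂ} (hf : Continuous f) (hf0 : f 0 = 0) {R : Measure ℝ}
    [IsProbabilityMeasure R] {n : ℕ} (hn : n ≠ 0)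
    (h : ∀ ξ, charFun R ξ ^ n = Complex.exp (f ξ)) (ξ : ℝ) :
    charFun R ξ = Complex.exp (f ξ / n) := by
  have hn' : (n : ℂ) ≠ 0 := Nat.cast_ne_zero.2 hn
  let T : Set ℂ := {z | z ^ n = 1}
  have hT : T.Finite := by
    refine (Polynomial.nthRoots n (1 : ℂ)).toFinset.finite_toSet.subset fun z hz => ?_
    simpa [Polynomial.mem_nthRoots (Nat.pos_of_ne_zero hn)] using show z ^ n = 1 from hz
  let g : ℝ → ℂ := fun ξ => charFun R ξ * Complex.exp (-(f ξ / n))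
  have hg : Continuous g := by fun_prop
  have hgT : Set.MapsTo g Set.univ T := fun x _ => by
    simp only [T, g, Set.mem_ofPred_eq, mul_pow, h, ← Complex.exp_nat_mul, ← Complex.exp_add]
    rw [mul_neg, mul_div_cancel₀ _ hn', add_neg_cancel, Complex.exp_zero]
  have h1 : g ξ = g 0 := isPreconnected_univ.constant_of_mapsTo hT.isDiscrete
    hg.continuousOn hgT (Set.mem_univ _) (Set.mem_univ _)
  simp only [g, hf0, charFun_zero, Complex.exp_neg] at h1
  rw [← div_eq_mul_inv, div_eq_iff (Complex.exp_ne_zero _)] at h1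
  simpa using h1

theorem tendsto_nat_mul_exp_div_sub_one (z : ℂ) :
    Tendsto (fun n : ℕ => (n : ℂ) * (Complex.exp (z / n) - 1)) atTop (𝓝 z) := by
  have h : HasDerivAt (fun t : ℂ => Complex.exp (t * z)) z 0 := by
    simpa using ((hasDerivAt_id (0 : ℂ)).mul_const z).cexp
  have h1 := h.tendsto_slope_zero
  have h2 : Tendsto (fun n : ℕ => ((n : ℂ))⁻¹) atTop (𝓝[≠] 0) := by
    refine tendsto_nhdsWithin_iff.2 ⟨tendsto_inv_atTop_nhds_zero_nat, ?_⟩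
    filter_upwards [eventually_ne_atTop 0] with n hn
    simpa using hn
  refine (h1.comp h2).congr fun n => ?_
  simp [div_eq_mul_inv, mul_comm]

/-- `τ f` is the limit of the exponents `n τ (exp (f / n) - 1)` of the compound-Poisson laws with
rate `n τ` whose jumps are distributed as the `n`-th root of the law with exponent `f`. -/
theorem IsLevyExponent.exists_charFun_eq {f : ℝ → ℂ} (hf : IsLevyExponent f) {τ : ℝ}
    (hτ : 0 ≤ τ) :
    ∃ P : Measure ℝ, IsProbabilityMeasure P ∧ ∀ ξ, charFun P ξ = Complex.exp (τ * f ξ) := by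
  obtain ⟨Q, hQ⟩ := hf
  have := hQ.isProbabilityMeasure
  choose R hR hRQ using fun n : ℕ => hQ.infinitelyDivisible (n + 1) n.succ_pos
  have hc : ∀ n ξ, charFun (R n) ξ = Complex.exp (f ξ / (n + 1 : ℕ)) := fun n =>
    charFun_root_eq hQ.continuous hQ.map_zero n.succ_ne_zero fun ξ => by
      rw [← charFun_iidSumLaw, hRQ, hQ.charFun_eq]
  have hpos : ∀ n : ℕ, 0 ≤ ((n + 1 : ℕ) : ℝ) * τ := fun n => by positivity
  have := fun n : ℕ => isProbabilityMeasure_compoundPoissonLaw (hpos n) (R n)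
  refine exists_charFun_eq_of_tendsto
    (P := fun n : ℕ => compoundPoissonLaw (((n + 1 : ℕ) : ℝ) * τ) (R n)) ?_ fun ξ => ?_
  · have := hQ.continuous
    fun_prop
  · simp_rw [fun n : ℕ => charFun_compoundPoissonLaw (hpos n) (R n) ξ, hc]
    have h := ((tendsto_nat_mul_exp_div_sub_one (f ξ)).comp (tendsto_add_atTop_nat 1)).const_mul
      (τ : ℂ)
    refine ((Complex.continuous_exp.tendsto _).comp h).congr fun n => ?_
    simp only [Function.comp_apply]
    push_cast
    ring_nf

theorem IsLevyExponent.exists_hasLevyExponent_mul {f : ℝ → ℂ} (hf : IsLevyExponent f) {τ : ℝ}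
    (hτ : 0 ≤ τ) : ∃ P : Measure ℝ, HasLevyExponent P (fun ξ => τ * f ξ) := by
  obtain ⟨P, hP, hPf⟩ := hf.exists_charFun_eq hτ
  refine ⟨P, hP, fun n hn => ?_, ?_, ?_, hPf⟩
  · obtain ⟨R, hR, hRf⟩ := hf.exists_charFun_eq (τ := τ / n) (by positivity)
    refine ⟨R, hR, iidSumLaw_eq_of_charFun_pow fun ξ => ?_⟩
    have hn' : (n : ℂ) ≠ 0 := Nat.cast_ne_zero.2 (by omega)
    rw [hRf, hPf, ← Complex.exp_nat_mul]
    push_cast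
    congr 1
    field_simp
  · obtain ⟨Q, hQ⟩ := hf
    have := hQ.continuous
    fun_prop
  · obtain ⟨Q, hQ⟩ := hf
    simp [hQ.map_zero]

/-! ### The exponent and the triplet of a compound-Poisson law -/

theorem HasLevyExponent.compoundPoissonLaw {P : Measure ℝ} {f : ℝ → ℂ} {r τ : ℝ} (hr : 0 ≤ r)
    (hP : HasLevyExponent P (fun ξ => τ * f ξ)) :
    HasLevyExponent (compoundPoissonLaw r P) (poissonExponent r τ f) := by
  have := hP.isProbabilityMeasure
  have hprob := isProbabilityMeasure_compoundPoissonLaw hr P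
  refine ⟨hprob, fun n hn => ?_, ?_, ?_, fun ξ => ?_⟩
  · have hrn : 0 ≤ r / n := by positivity
    have := isProbabilityMeasure_compoundPoissonLaw hrn P
    refine ⟨_, this, iidSumLaw_eq_of_charFun_pow fun ξ => ?_⟩
    have hn' : (n : ℂ) ≠ 0 := Nat.cast_ne_zero.2 (by omega)
    rw [charFun_compoundPoissonLaw hrn, charFun_compoundPoissonLaw hr, ← Complex.exp_nat_mul]
    push_cast
    congr 1
    field_simp
  · have := hP.continuous
    unfold poissonExponent
    fun_prop
  · have := hP.map_zero
    simp [poissonExponent, this]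
  · rw [charFun_compoundPoissonLaw hr, hP.charFun_eq, poissonExponent]

instance isFiniteMeasure_jumpMeasure (r : ℝ) (P : Measure ℝ) [IsProbabilityMeasure P] :
    IsFiniteMeasure (jumpMeasure r P) := by
  unfold jumpMeasure
  exact Measure.smul_finite _ ENNReal.ofReal_ne_top

theorem isLevyMeasure_jumpMeasure (r : ℝ) (P : Measure ℝ) [IsProbabilityMeasure P] :
    IsLevyMeasure (jumpMeasure r P) := by
  refine ⟨by simp [jumpMeasure], ?_⟩
  calc ∫⁻ t, ENNReal.ofReal (min 1 (t ^ 2)) ∂jumpMeasure r P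
      ≤ ∫⁻ _, 1 ∂jumpMeasure r P := by
        gcongr
        simp
    _ < ∞ := by simp

/-- A compound-Poisson law has no Gaussian part, and its drift is the compensator of its jumps
of modulus at most `1`. -/
theorem levyKhintchine_jumpMeasure {r : ℝ} (hr : 0 ≤ r) (P : Measure ℝ) [IsProbabilityMeasure P]
    (ξ : ℝ) :
    levyKhintchine (r * ∫ t in {t : ℝ | |t| ≤ 1}, t ∂P) 0 (jumpMeasure r P) ξ =
      r * (charFun P ξ - 1) := by
  have hm : MeasurableSet {s : ℝ | |s| ≤ 1} := measurableSet_le (by fun_prop) (by fun_prop)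
  rw [levyKhintchine, jumpMeasure, integral_smul_measure, ENNReal.toReal_ofReal hr,
    setIntegral_eq_integral_of_forall_compl_eq_zero (s := {0}ᶜ)]
  · have h5 : Integrable (fun t : ℝ => Complex.exp (Complex.I * (ξ * t : ℝ))) P := by
      refine Integrable.of_bound (C := 1) (by fun_prop) (ae_of_all _ fun x => ?_)
      rw [mul_comm, Complex.norm_exp_ofReal_mul_I]
    have h1 : Integrable (fun t : ℝ => Complex.exp (Complex.I * (ξ * t : ℝ)) - 1) P :=
      h5.sub (integrable_const _)
    have h2 : Integrable (Set.indicator {s : ℝ | |s| ≤ 1} (id : ℝ → ℝ)) P := by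
      refine Integrable.of_bound (C := 1)
        (measurable_id.indicator hm).aestronglyMeasurable (ae_of_all _ fun x => ?_)
      by_cases hx : |x| ≤ 1 <;> simp [Set.indicator, hx]
    have h3 : Integrable (fun t : ℝ => Complex.I *
        ((ξ * Set.indicator {s : ℝ | |s| ≤ 1} id t : ℝ) : ℂ)) P :=
      ((h2.const_mul ξ).ofReal).const_mul _
    rw [integral_sub h1 h3, integral_sub h5 (integrable_const _),
      integral_const_mul, integral_complex_ofReal, integral_const_mul, integral_indicator hm,
      charFun_apply_real]
    have h4 : ∀ t : ℝ, Complex.exp (Complex.I * (ξ * t : ℝ)) =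
        Complex.exp (ξ * t * Complex.I) := fun t => by
      rw [mul_comm Complex.I, Complex.ofReal_mul]
    simp_rw [h4]
    simp only [id, integral_const, probReal_univ, one_smul, NNReal.coe_zero, zero_mul, zero_div,
      Complex.real_smul]
    push_cast
    ring
  · intro x hx
    have hx0 : x = 0 := by simpa using hx
    simp [hx0]

theorem HasLevyExponent.hasLevyTriplet_poissonExponent {P : Measure ℝ} {f : ℝ → ℂ} {r τ : ℝ}
    (hr : 0 ≤ r) (hP : HasLevyExponent P (fun ξ => τ * f ξ)) :
    HasLevyTriplet (poissonExponent r τ f)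
      (r * ∫ t in {t : ℝ | |t| ≤ 1}, t ∂P) 0 (jumpMeasure r P) := by
  have := hP.isProbabilityMeasure
  refine ⟨⟨_, hP.compoundPoissonLaw hr⟩, isLevyMeasure_jumpMeasure r P, fun ξ => ?_⟩
  rw [levyKhintchine_jumpMeasure hr, hP.charFun_eq, poissonExponent]

/-! ### Symmetry -/

theorem IsSymmetric.map_neg {V : Measure ℝ} (hV : IsSymmetric V) :
    V.map (MeasurableEquiv.neg ℝ) = V := hV

theorem levyKhintchine_neg {V : Measure ℝ} (hV : IsSymmetric V) (v : ℝ≥0) (ξ : ℝ) :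
    levyKhintchine 0 v V (-ξ) = levyKhintchine 0 v V ξ := by
  unfold levyKhintchine
  congr 1
  · simp
  · conv_rhs => rw [← hV.map_neg, (MeasurableEquiv.neg ℝ).measurableEmbedding.integral_map]
    refine integral_congr_ae (ae_of_all _ fun t => ?_)
    have : Set.indicator {s : ℝ | |s| ≤ 1} id (-t) = -Set.indicator {s : ℝ | |s| ≤ 1} id t := by
      by_cases ht : |t| ≤ 1 <;> simp [Set.indicator, ht]
    simp [this]

theorem isSymmetric_of_charFun_neg {P : Measure ℝ} [IsProbabilityMeasure P]
    (h : ∀ ξ, charFun P (-ξ) = charFun P ξ) : IsSymmetric P := by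
  have : IsProbabilityMeasure (P.map fun t => -t) :=
    Measure.isProbabilityMeasure_map (by fun_prop)
  refine Measure.ext_of_charFun (funext fun ξ => ?_)
  have h1 := charFun_map_mul (μ := P) (-1) ξ
  simp only [neg_mul, one_mul] at h1
  rw [h1, h]

theorem IsSymmetric.jumpMeasure {P : Measure ℝ} (hP : IsSymmetric P) (r : ℝ) :
    IsSymmetric (jumpMeasure r P) := by
  unfold IsSymmetric LevyExponents.jumpMeasure
  rw [Measure.map_smul]
  congr 1
  conv_rhs => rw [← hP, Measure.restrict_map (by fun_prop) (measurableSet_singleton _).compl]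
  congr 2
  ext t
  simp

theorem IsSymmetric.setIntegral_id_eq_zero {P : Measure ℝ} (hP : IsSymmetric P) :
    ∫ t in {t : ℝ | |t| ≤ 1}, t ∂P = 0 := by
  have h : ∫ t in {t : ℝ | |t| ≤ 1}, t ∂P = ∫ t in {t : ℝ | |t| ≤ 1}, -t ∂P := by
    conv_lhs => rw [← hP.map_neg, (MeasurableEquiv.neg ℝ).measurableEmbedding.setIntegral_map]
    simp
  rw [integral_neg] at h
  linarith

/-! ### Moments in terms of `1 - cos` -/

theorem one_sub_cos_le (x : ℝ) : 1 - Real.cos x ≤ x ^ 2 / 2 := by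
  linarith [Real.one_sub_sq_div_two_le_cos (x := x)]

theorem le_one_sub_cos {x : ℝ} (hx : |x| ≤ Real.pi) :
    2 / Real.pi ^ 2 * x ^ 2 ≤ 1 - Real.cos x := by
  linarith [Real.cos_le_one_sub_mul_cos_sq hx]

/-- The weights `2 ^ (k p)` on the frequencies `2 ^ (-k)` make `∑ k, w k (1 - cos (2 ^ (-k) t))`
comparable with `|t| ^ p` for `|t| ≥ 1`, when `0 < p < 2`. -/
theorem exists_dyadic_weights_of_lt {p : ℝ} (hp0 : 0 < p) (hp2 : p < 2) :
    ∃ (w : ℕ → ℕ → ℝ) (C c : ℝ), 0 < c ∧ (∀ n k, 0 ≤ w n k) ∧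
      (∀ n, ∑ k ∈ Finset.range (n + 1), w n k * (1 / 4) ^ k ≤ C) ∧
      (∀ n t, 1 ≤ |t| →
        ∑ k ∈ Finset.range (n + 1), w n k * (1 - Real.cos (t / 2 ^ k)) ≤ C * |t| ^ p) ∧
      ∀ t, 1 ≤ |t| → ∀ᶠ n in atTop,
        c * |t| ^ p ≤ ∑ k ∈ Finset.range (n + 1), w n k * (1 - Real.cos (t / 2 ^ k)) := by
  obtain ⟨a, ha⟩ : ∃ a : ℝ, a = 2 ^ p := ⟨_, rfl⟩
  have ha1 : 1 < a := ha ▸ Real.one_lt_rpow (by norm_num) hp0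
  have ha4 : a < 4 := by
    have := Real.rpow_lt_rpow_of_exponent_lt (x := 2) (by norm_num) hp2
    rw [ha]
    norm_num at this ⊢
    exact this
  obtain ⟨B, hB⟩ : ∃ B : ℝ, B = (1 - a / 4)⁻¹ := ⟨_, rfl⟩
  obtain ⟨D, hD⟩ : ∃ D : ℝ, D = 2 / (a - 1) := ⟨_, rfl⟩
  have hB0 : 0 < B := hB ▸ inv_pos.2 (by linarith)
  have hD0 : 0 < D := hD ▸ div_pos two_pos (by linarith)
  have hDa : D * (a - 1) = 2 := by rw [hD]; field_simp [sub_ne_zero.2 ha1.ne']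
  have hgeom : ∀ n, ∑ k ∈ Finset.range n, a ^ k * (1 / 4) ^ k ≤ B := fun n => by
    have h1 : a / 4 < 1 := by linarith
    have h0 : 0 ≤ a / 4 := by linarith
    simp_rw [← mul_pow, mul_one_div]
    rw [hB, ← tsum_geometric_of_lt_one h0 h1]
    exact (summable_geometric_of_lt_one h0 h1).sum_le_tsum _ fun _ _ => by positivity
  have hsmall : ∀ n t, ∑ k ∈ Finset.range n, a ^ k * (1 - Real.cos (t / 2 ^ k)) ≤
      B * (t ^ 2 / 2) := fun n t => by
    refine le_trans ?_ (mul_le_mul_of_nonneg_right (hgeom n) (by positivity))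
    rw [Finset.sum_mul]
    refine Finset.sum_le_sum fun k _ => ?_
    rw [mul_assoc]
    refine mul_le_mul_of_nonneg_left ((one_sub_cos_le _).trans_eq ?_) (by positivity)
    rw [div_pow, ← pow_mul, mul_comm k, pow_mul, one_div, inv_pow]
    norm_num
    ring
  -- The subtracted constant `D` absorbs the term of frequency `1` in the inductive step, which
  -- replaces `t` by `t / 2`.
  have hlarge : ∀ n t, 1 ≤ |t| → ∑ k ∈ Finset.range n, a ^ k * (1 - Real.cos (t / 2 ^ k)) ≤
      (2 * B + D) * |t| ^ p - D := fun n => by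
    induction n with
    | zero =>
      intro t ht
      have := Real.one_le_rpow ht hp0.le
      simp only [Finset.range_zero, Finset.sum_empty]
      nlinarith
    | succ n ih =>
      intro t ht
      rcases lt_or_ge |t| 2 with h2 | h2
      · refine (hsmall _ t).trans ?_
        have := Real.one_le_rpow ht hp0.le
        have h3 : t ^ 2 ≤ 4 := by rw [← sq_abs]; nlinarith
        nlinarith
      · have h4 : |t / 2| = |t| / 2 := by rw [abs_div, abs_two]
        have h3 := ih (t / 2) (by rw [h4]; linarith)
        rw [h4, Real.div_rpow (abs_nonneg t) two_pos.le, ← ha] at h3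
        have h5 : ∀ k : ℕ, a ^ (k + 1) * (1 - Real.cos (t / 2 ^ (k + 1))) =
            a * (a ^ k * (1 - Real.cos (t / 2 / 2 ^ k))) := fun k => by
          rw [div_div, ← pow_succ', pow_succ' a]
          ring
        rw [Finset.sum_range_succ']
        simp_rw [h5]
        rw [← Finset.mul_sum]
        have h6 := mul_le_mul_of_nonneg_left h3 (by linarith : 0 ≤ a)
        have h7 : a * ((2 * B + D) * (|t| ^ p / a) - D) = (2 * B + D) * |t| ^ p - a * D := by
          field_simp
        have h8 := Real.neg_one_le_cos (t / 2 ^ 0)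
        rw [h7] at h6
        linarith
  refine ⟨fun _ k => a ^ k, 2 * B + D, 2 / Real.pi ^ 2 / a, by positivity,
    fun _ k => by positivity, fun n => (hgeom _).trans (by linarith),
    fun n t ht => (hlarge _ t ht).trans (by linarith), fun t ht => ?_⟩
  -- For `2 ^ k ≤ |t| < 2 ^ (k + 1)` the `k`-th term alone is of the order of `|t| ^ p`.
  obtain ⟨k, hk1, hk2⟩ := exists_nat_pow_near ht one_lt_two
  filter_upwards [eventually_ge_atTop k] with n hn
  refine le_trans ?_ (Finset.single_le_sum (f := fun k => a ^ k * (1 - Real.cos (t / 2 ^ k)))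
    (fun k _ => mul_nonneg (by positivity) (by linarith [Real.cos_le_one (t / 2 ^ k)]))
    (Finset.mem_range.2 (Nat.lt_succ_of_le hn)))
  have hu : |t / 2 ^ k| = |t| / 2 ^ k := by rw [abs_div, abs_pow, abs_two]
  have hu1 : 1 ≤ |t / 2 ^ k| := by rw [hu, le_div_iff₀ (by positivity)]; linarith
  have hu2 : |t / 2 ^ k| ≤ 2 := by
    rw [hu, div_le_iff₀ (by positivity), ← pow_succ']; exact hk2.le
  have h1 := le_one_sub_cos (hu2.trans (by linarith [Real.pi_gt_three]))
  have h2 : 1 ≤ (t / 2 ^ k) ^ 2 := by rw [← sq_abs]; nlinarith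
  have h3 : 2 / Real.pi ^ 2 ≤ 1 - Real.cos (t / 2 ^ k) :=
    le_trans (le_mul_of_one_le_right (by positivity) h2) h1
  have h4 : |t| ^ p / a ≤ a ^ k := by
    rw [div_le_iff₀ (by positivity), ← pow_succ, ha, ← Real.rpow_natCast (2 ^ p),
      ← Real.rpow_mul two_pos.le, mul_comm p, Real.rpow_mul two_pos.le, Real.rpow_natCast]
    exact Real.rpow_le_rpow (abs_nonneg _) hk2.le hp0.le
  calc 2 / Real.pi ^ 2 / a * |t| ^ p = |t| ^ p / a * (2 / Real.pi ^ 2) := by ring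
    _ ≤ a ^ k * (1 - Real.cos (t / 2 ^ k)) := by gcongr

/-- The analogue of `exists_dyadic_weights_of_lt` at the end point `p = 2`, where the single term
`4 ^ n (1 - cos (2 ^ (-n) t))` replaces the sum. -/
theorem exists_dyadic_weights_two :
    ∃ (w : ℕ → ℕ → ℝ) (C c : ℝ), 0 < c ∧ (∀ n k, 0 ≤ w n k) ∧
      (∀ n, ∑ k ∈ Finset.range (n + 1), w n k * (1 / 4) ^ k ≤ C) ∧
      (∀ n t, 1 ≤ |t| →
        ∑ k ∈ Finset.range (n + 1), w n k * (1 - Real.cos (t / 2 ^ k)) ≤ C * |t| ^ (2 : ℝ)) ∧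
      ∀ t, 1 ≤ |t| → ∀ᶠ n in atTop,
        c * |t| ^ (2 : ℝ) ≤ ∑ k ∈ Finset.range (n + 1), w n k * (1 - Real.cos (t / 2 ^ k)) := by
  have hsq : ∀ (n : ℕ) (t : ℝ), (4 : ℝ) ^ n * (t / 2 ^ n) ^ 2 = t ^ 2 := fun n t => by
    rw [div_pow, ← pow_mul, mul_comm n, pow_mul, show (2 : ℝ) ^ 2 = 4 by norm_num]
    field_simp
  refine ⟨fun n k => if k = n then 4 ^ n else 0, 1, 2 / Real.pi ^ 2, by positivity,
    fun n k => by dsimp only; split_ifs <;> positivity, fun n => ?_, fun n t _ => ?_, fun t _ => ?_⟩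
  · simp
  · simp only [ite_mul, zero_mul, Finset.sum_ite_eq', Finset.self_mem_range_succ, if_true,
      Real.rpow_two, sq_abs]
    have := mul_le_mul_of_nonneg_left (one_sub_cos_le (t / 2 ^ n))
      (by positivity : (0 : ℝ) ≤ 4 ^ n)
    nlinarith [hsq n t, sq_nonneg t]
  · filter_upwards [(tendsto_pow_atTop_atTop_of_one_lt (one_lt_two (α := ℝ))).eventually_ge_atTop
      |t|] with n hn
    simp only [ite_mul, zero_mul, Finset.sum_ite_eq', Finset.self_mem_range_succ, if_true,
      Real.rpow_two, sq_abs]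
    have hu : |t / 2 ^ n| ≤ 1 := by
      rw [abs_div, abs_pow, abs_two, div_le_one (by positivity)]; exact hn
    have := mul_le_mul_of_nonneg_left
      (le_one_sub_cos (hu.trans (by linarith [Real.pi_gt_three])))
      (by positivity : (0 : ℝ) ≤ 4 ^ n)
    rwa [mul_left_comm, hsq] at this

theorem exists_dyadic_weights {p : ℝ} (hp0 : 0 < p) (hp2 : p ≤ 2) :
    ∃ (w : ℕ → ℕ → ℝ) (C c : ℝ), 0 < c ∧ (∀ n k, 0 ≤ w n k) ∧
      (∀ n, ∑ k ∈ Finset.range (n + 1), w n k * (1 / 4) ^ k ≤ C) ∧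
      (∀ n t, 1 ≤ |t| →
        ∑ k ∈ Finset.range (n + 1), w n k * (1 - Real.cos (t / 2 ^ k)) ≤ C * |t| ^ p) ∧
      ∀ t, 1 ≤ |t| → ∀ᶠ n in atTop,
        c * |t| ^ p ≤ ∑ k ∈ Finset.range (n + 1), w n k * (1 - Real.cos (t / 2 ^ k)) := by
  rcases hp2.lt_or_eq with h | rfl
  · exact exists_dyadic_weights_of_lt hp0 h
  · exact exists_dyadic_weights_two

theorem measurableSet_one_le_abs : MeasurableSet {t : ℝ | 1 ≤ |t|} :=
  measurableSet_le (by fun_prop) (by fun_prop)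

theorem compl_one_le_abs : {t : ℝ | 1 ≤ |t|}ᶜ = {t : ℝ | |t| < 1} := by
  ext t
  simp

/-- A bound of the integrals `∫ (1 - cos (ξ t)) Q(dt)` by those of `V`, up to a term quadratic in `ξ`, transfers the finiteness of the `p`-th moment of the large values from `V` to `Q`. -/
theorem lintegral_rpow_lt_top_of_lintegral_one_sub_cos_le {Q V : Measure ℝ} {p : ℝ} (hp0 : 0 < p)
    (hp2 : p ≤ 2) (hV : ∫⁻ t in {t : ℝ | |t| < 1}, ENNReal.ofReal (t ^ 2) ∂V < ∞)
    (hVp : ∫⁻ t in {t : ℝ | 1 ≤ |t|}, ENNReal.ofReal (|t| ^ p) ∂V < ∞)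
    {A B : ℝ≥0∞} (hA : A ≠ ∞) (hB : B ≠ ∞)
    (h : ∀ ξ : ℝ, ∫⁻ t, ENNReal.ofReal (1 - Real.cos (ξ * t)) ∂Q ≤
      A * ENNReal.ofReal (ξ ^ 2) + B * ∫⁻ t, ENNReal.ofReal (1 - Real.cos (ξ * t)) ∂V) :
    ∫⁻ t in {t : ℝ | 1 ≤ |t|}, ENNReal.ofReal (|t| ^ p) ∂Q < ∞ := by
  obtain ⟨w, C, c, hc, hw, hw1, hw2, hw3⟩ := exists_dyadic_weights hp0 hp2
  have hcos : ∀ x : ℝ, 0 ≤ 1 - Real.cos x := fun x => by linarith [Real.cos_le_one x]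
  have hC : 0 ≤ C :=
    (Finset.sum_nonneg fun k _ => mul_nonneg (hw 0 k) (by positivity)).trans (hw1 0)
  let G : ℕ → ℝ → ℝ := fun n t => ∑ k ∈ Finset.range (n + 1), w n k * (1 - Real.cos (t / 2 ^ k))
  have hGm : ∀ n, Measurable fun t => ENNReal.ofReal (G n t) := fun n => by
    have : Continuous (G n) := by fun_prop
    exact this.measurable.ennreal_ofReal
  have hG : ∀ (μ : Measure ℝ) (n : ℕ), ∫⁻ t, ENNReal.ofReal (G n t) ∂μ =
      ∑ k ∈ Finset.range (n + 1), ENNReal.ofReal (w n k) *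
        ∫⁻ t, ENNReal.ofReal (1 - Real.cos ((2 ^ k)⁻¹ * t)) ∂μ := fun μ n => by
    have h1 : ∀ t, ENNReal.ofReal (G n t) = ∑ k ∈ Finset.range (n + 1), ENNReal.ofReal (w n k) *
        ENNReal.ofReal (1 - Real.cos ((2 ^ k)⁻¹ * t)) := fun t => by
      rw [ENNReal.ofReal_sum_of_nonneg fun k _ => mul_nonneg (hw n k) (hcos _)]
      simp_rw [ENNReal.ofReal_mul (hw n _), inv_mul_eq_div]
    simp_rw [h1]
    rw [lintegral_finsetSum _ fun k _ => by fun_prop]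
    exact Finset.sum_congr rfl fun k _ => lintegral_const_mul _ (by fun_prop)
  have hGsmall : ∀ n t, G n t ≤ C * t ^ 2 := fun n t => by
    refine le_trans ?_ (mul_le_mul_of_nonneg_right (hw1 n) (sq_nonneg t))
    rw [Finset.sum_mul]
    refine Finset.sum_le_sum fun k _ => ?_
    rw [mul_assoc]
    refine mul_le_mul_of_nonneg_left ((one_sub_cos_le _).trans ?_) (hw n k)
    rw [div_pow, ← pow_mul, mul_comm k, pow_mul, one_div, inv_pow,
      show (2 : ℝ) ^ 2 = 4 by norm_num, div_eq_inv_mul (t ^ 2)]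
    have : 0 ≤ ((4 : ℝ) ^ k)⁻¹ * t ^ 2 := by positivity
    linarith
  have hGV : ∀ n, ∫⁻ t, ENNReal.ofReal (G n t) ∂V ≤
      ENNReal.ofReal C * ∫⁻ t in {t : ℝ | 1 ≤ |t|}, ENNReal.ofReal (|t| ^ p) ∂V +
        ENNReal.ofReal C * ∫⁻ t in {t : ℝ | |t| < 1}, ENNReal.ofReal (t ^ 2) ∂V := fun n => by
    rw [← lintegral_add_compl _ measurableSet_one_le_abs, compl_one_le_abs,
      ← lintegral_const_mul _ (by fun_prop), ← lintegral_const_mul _ (by fun_prop)]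
    simp_rw [← ENNReal.ofReal_mul hC]
    gcongr ?_ + ?_
    · exact setLIntegral_mono (by fun_prop) fun t ht => ENNReal.ofReal_le_ofReal (hw2 n t ht)
    · exact lintegral_mono fun t => ENNReal.ofReal_le_ofReal (hGsmall n t)
  obtain ⟨M, hM⟩ : ∃ M, M = ENNReal.ofReal C *
      ∫⁻ t in {t : ℝ | 1 ≤ |t|}, ENNReal.ofReal (|t| ^ p) ∂V +
        ENNReal.ofReal C * ∫⁻ t in {t : ℝ | |t| < 1}, ENNReal.ofReal (t ^ 2) ∂V := ⟨_, rfl⟩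
  have hMtop : M ≠ ∞ := by
    rw [hM]
    exact ENNReal.add_ne_top.2 ⟨ENNReal.mul_ne_top ENNReal.ofReal_ne_top hVp.ne,
      ENNReal.mul_ne_top ENNReal.ofReal_ne_top hV.ne⟩
  have hGQ : ∀ n, ∫⁻ t, ENNReal.ofReal (G n t) ∂Q ≤ A * ENNReal.ofReal C + B * M := fun n => by
    calc ∫⁻ t, ENNReal.ofReal (G n t) ∂Q
        ≤ ∑ k ∈ Finset.range (n + 1), ENNReal.ofReal (w n k) *
          (A * ENNReal.ofReal (((2 : ℝ) ^ k)⁻¹ ^ 2) +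
            B * ∫⁻ t, ENNReal.ofReal (1 - Real.cos ((2 ^ k)⁻¹ * t)) ∂V) := by
          rw [hG]
          gcongr with k
          exact h _
      _ = A * ENNReal.ofReal (∑ k ∈ Finset.range (n + 1), w n k * (1 / 4) ^ k) +
          B * ∫⁻ t, ENNReal.ofReal (G n t) ∂V := by
          have h4 : ∀ k : ℕ, ((2 : ℝ) ^ k)⁻¹ ^ 2 = (1 / 4) ^ k := fun k => by
            rw [inv_pow, ← pow_mul, mul_comm k, pow_mul, one_div, inv_pow]
            norm_num
          rw [hG, ENNReal.ofReal_sum_of_nonneg fun k _ => mul_nonneg (hw n k) (by positivity),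
            Finset.mul_sum, Finset.mul_sum, ← Finset.sum_add_distrib]
          refine Finset.sum_congr rfl fun k _ => ?_
          rw [ENNReal.ofReal_mul (hw n k), h4]
          ring
      _ ≤ A * ENNReal.ofReal C + B * M := by
          gcongr
          · exact hw1 n
          · exact (hGV n).trans_eq hM.symm
  have hfatou : ENNReal.ofReal c * ∫⁻ t in {t : ℝ | 1 ≤ |t|}, ENNReal.ofReal (|t| ^ p) ∂Q ≤
      A * ENNReal.ofReal C + B * M := by
    rw [← lintegral_const_mul _ (by fun_prop)]
    simp_rw [← ENNReal.ofReal_mul hc.le]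
    calc ∫⁻ t in {t : ℝ | 1 ≤ |t|}, ENNReal.ofReal (c * |t| ^ p) ∂Q
        ≤ ∫⁻ t in {t : ℝ | 1 ≤ |t|}, liminf (fun n => ENNReal.ofReal (G n t)) atTop ∂Q := by
          refine setLIntegral_mono (.liminf hGm) fun t ht => ?_
          refine le_liminf_of_le (by isBoundedDefault) ?_
          filter_upwards [hw3 t ht] with n hn
          exact ENNReal.ofReal_le_ofReal hn
      _ ≤ liminf (fun n => ∫⁻ t in {t : ℝ | 1 ≤ |t|}, ENNReal.ofReal (G n t) ∂Q) atTop :=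
          lintegral_liminf_le hGm
      _ ≤ liminf (fun _ : ℕ => A * ENNReal.ofReal C + B * M) atTop :=
          liminf_le_liminf (.of_forall fun n => (setLIntegral_le_lintegral _ _).trans (hGQ n))
      _ = A * ENNReal.ofReal C + B * M := by simp
  have htop : A * ENNReal.ofReal C + B * M ≠ ∞ :=
    ENNReal.add_ne_top.2 ⟨ENNReal.mul_ne_top hA ENNReal.ofReal_ne_top,
      ENNReal.mul_ne_top hB hMtop⟩
  refine ENNReal.lt_top_of_mul_ne_top_right (hfatou.trans_lt htop.lt_top).ne ?_
  simpa using hc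

/-! ### Moments of infinitely divisible laws -/

/-- Only an inequality is stated, so that no integrability of the Lévy-Khintchine integrand is
needed: if it fails, the integral has the value `0` and the bound is trivial. -/
theorem ofReal_neg_re_levyKhintchine_le (μ : ℝ) (v : ℝ≥0) (V : Measure ℝ) (ξ : ℝ) :
    ENNReal.ofReal (-(levyKhintchine μ v V ξ).re) ≤
      ENNReal.ofReal (v / 2) * ENNReal.ofReal (ξ ^ 2) +
        ∫⁻ t, ENNReal.ofReal (1 - Real.cos (ξ * t)) ∂V := by
  let F : ℝ → ℂ := fun t => Complex.exp (Complex.I * (ξ * t : ℝ)) - 1 -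
      Complex.I * (ξ * Set.indicator {s : ℝ | |s| ≤ 1} id t : ℝ)
  have hF : ∀ t, (F t).re = -(1 - Real.cos (ξ * t)) := fun t => by
    simp only [F, mul_comm Complex.I, Complex.sub_re, Complex.exp_ofReal_mul_I_re,
      Complex.one_re, Complex.re_ofReal_mul, Complex.I_re, mul_zero]
    ring
  have hre : -(levyKhintchine μ v V ξ).re = v / 2 * ξ ^ 2 + -(∫ t, F t ∂V).re := by
    simp only [levyKhintchine, F, mul_comm Complex.I, Complex.add_re, Complex.sub_re,
      Complex.re_ofReal_mul, Complex.I_re, mul_zero, Complex.ofReal_re]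
    ring
  rw [hre, ← ENNReal.ofReal_mul (by positivity)]
  refine ENNReal.ofReal_add_le.trans (add_le_add le_rfl ?_)
  by_cases hi : Integrable F V
  · have h1 : (∫ t, F t ∂V).re = ∫ t, -(1 - Real.cos (ξ * t)) ∂V := by
      simp_rw [← hF]
      exact (integral_re hi).symm
    have h2 : Integrable (fun t => -(1 - Real.cos (ξ * t))) V := by
      simp_rw [← hF]
      exact hi.re
    have h3 : Integrable (fun t => 1 - Real.cos (ξ * t)) V :=
      h2.neg.congr (ae_of_all _ fun t => neg_neg _)
    rw [h1, integral_neg, neg_neg, ofReal_integral_eq_lintegral_ofReal h3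
      (ae_of_all _ fun t => by simpa using Real.cos_le_one _)]
  · rw [integral_undef hi]
    simp

theorem lintegral_one_sub_cos_eq (Q : Measure ℝ) [IsProbabilityMeasure Q] (ξ : ℝ) :
    ∫⁻ t, ENNReal.ofReal (1 - Real.cos (ξ * t)) ∂Q = ENNReal.ofReal (1 - (charFun Q ξ).re) := by
  have h1 : Integrable (fun t : ℝ => Complex.exp (ξ * t * Complex.I)) Q := by
    refine Integrable.of_bound (C := 1) (by fun_prop) (ae_of_all _ fun x => ?_)
    rw [← Complex.ofReal_mul, Complex.norm_exp_ofReal_mul_I]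
  have h2 : Integrable (fun t : ℝ => Real.cos (ξ * t)) Q :=
    Integrable.of_bound (C := 1) (by fun_prop)
      (ae_of_all _ fun x => by simpa using Real.abs_cos_le_one _)
  have h3 : ∫ t : ℝ, (Complex.exp (ξ * t * Complex.I)).re ∂Q = (charFun Q ξ).re := by
    rw [charFun_apply_real]
    exact integral_re h1
  have h4 : ∀ t : ℝ, (Complex.exp (ξ * t * Complex.I)).re = Real.cos (ξ * t) := fun t => by
    rw [← Complex.ofReal_mul, Complex.exp_ofReal_mul_I_re]
  simp_rw [h4] at h3
  have h5 : Integrable (fun t : ℝ => 1 - Real.cos (ξ * t)) Q := (integrable_const _).sub h2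
  rw [← ofReal_integral_eq_lintegral_ofReal h5
    (ae_of_all _ fun t => by simpa using Real.cos_le_one _), integral_sub (integrable_const _) h2,
    h3]
  simp

/-- Desymmetrisation of moments: if `X - X'` has a finite `p`-th moment, with `X`, `X'` independent
of law `P`, then `X - x` has one for some constant `x`, and hence so has `X`. -/
theorem lintegral_rpow_lt_top_of_conv_neg {P : Measure ℝ} [IsProbabilityMeasure P] {p : ℝ}
    (hp : 0 ≤ p)
    (h : ∫⁻ t in {t : ℝ | 1 ≤ |t|}, ENNReal.ofReal (|t| ^ p) ∂(P ∗ P.map fun t => -t) < ∞) :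
    ∫⁻ t, ENNReal.ofReal (|t| ^ p) ∂P < ∞ := by
  have : IsProbabilityMeasure (P.map fun t => -t) :=
    Measure.isProbabilityMeasure_map (by fun_prop)
  have h1 : ∫⁻ t, ENNReal.ofReal (|t| ^ p) ∂(P ∗ P.map fun t => -t) < ∞ := by
    rw [← lintegral_add_compl _ measurableSet_one_le_abs, compl_one_le_abs]
    refine ENNReal.add_lt_top.2 ⟨h, ?_⟩
    calc ∫⁻ t in {t : ℝ | |t| < 1}, ENNReal.ofReal (|t| ^ p) ∂(P ∗ P.map fun t => -t)
        ≤ ∫⁻ _ in {t : ℝ | |t| < 1}, 1 ∂(P ∗ P.map fun t => -t) := by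
          refine setLIntegral_mono (by fun_prop) fun t ht => ?_
          rw [← ENNReal.ofReal_one]
          exact ENNReal.ofReal_le_ofReal (Real.rpow_le_one (abs_nonneg _) (le_of_lt ht) hp)
      _ < ∞ := by simp
  rw [Measure.lintegral_conv (by fun_prop)] at h1
  obtain ⟨x, hx⟩ := (ae_lt_top (by fun_prop) h1.ne).exists
  rw [lintegral_map (by fun_prop) (by fun_prop)] at hx
  have h2 : ∀ y : ℝ, ENNReal.ofReal (|y| ^ p) ≤
      ENNReal.ofReal (2 ^ p) * (ENNReal.ofReal (|x + -y| ^ p) + ENNReal.ofReal (|x| ^ p)) := by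
    intro y
    rw [← ENNReal.ofReal_add (by positivity) (by positivity), ← ENNReal.ofReal_mul (by positivity)]
    refine ENNReal.ofReal_le_ofReal ?_
    have hy : |y| ≤ 2 * max |x + -y| |x| := by
      have := abs_sub_abs_le_abs_sub y x
      rw [abs_sub_comm, sub_eq_add_neg x] at this
      linarith [le_max_left |x + -y| |x|, le_max_right |x + -y| |x|]
    calc |y| ^ p ≤ (2 * max |x + -y| |x|) ^ p := by gcongr
      _ = 2 ^ p * max |x + -y| |x| ^ p := Real.mul_rpow (by norm_num) (by positivity)
      _ ≤ 2 ^ p * (|x + -y| ^ p + |x| ^ p) := by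
        gcongr
        rcases max_choice |x + -y| |x| with hm | hm <;> rw [hm]
        · exact le_add_of_nonneg_right (by positivity)
        · exact le_add_of_nonneg_left (by positivity)
  calc ∫⁻ t, ENNReal.ofReal (|t| ^ p) ∂P
      ≤ ∫⁻ y, ENNReal.ofReal (2 ^ p) *
          (ENNReal.ofReal (|x + -y| ^ p) + ENNReal.ofReal (|x| ^ p)) ∂P := lintegral_mono h2
    _ = ENNReal.ofReal (2 ^ p) *
          (∫⁻ y, ENNReal.ofReal (|x + -y| ^ p) ∂P + ENNReal.ofReal (|x| ^ p)) := by
        rw [lintegral_const_mul _ (by fun_prop), lintegral_add_left (by fun_prop)]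
        simp
    _ < ∞ := ENNReal.mul_lt_top ENNReal.ofReal_lt_top
        (ENNReal.add_lt_top.2 ⟨hx, ENNReal.ofReal_lt_top⟩)

theorem IsLevyMeasure.lintegral_sq_lt_top {V : Measure ℝ} (hV : IsLevyMeasure V) :
    ∫⁻ t in {t : ℝ | |t| < 1}, ENNReal.ofReal (t ^ 2) ∂V < ∞ := by
  refine lt_of_le_of_lt ?_ hV.lintegral_lt_top
  refine (setLIntegral_mono (g := fun t => ENNReal.ofReal (min 1 (t ^ 2))) (by fun_prop)
    fun t ht => ?_).trans (setLIntegral_le_lintegral _ _)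
  have : t ^ 2 ≤ 1 := by rw [← sq_abs]; exact pow_le_one₀ (abs_nonneg t) (le_of_lt ht)
  rw [min_eq_right this]

/-- An infinitely divisible law inherits the moments of order `p ≤ 2` from the large jumps. The
characteristic function `φ` of its symmetrisation satisfies
`1 - φ = 1 - exp (2 τ Re f) ≤ -2 τ Re f`, and the right-hand side is the Lévy-Khintchine integral
of `1 - cos`. -/
theorem HasLevyTriplet.lintegral_rpow_lt_top {f : ℝ → ℂ} {μ : ℝ} {v : ℝ≥0} {V P : Measure ℝ}
    (hf : HasLevyTriplet f μ v V) {τ : ℝ} (hτ : 0 ≤ τ) (hP : HasLevyExponent P fun ξ => τ * f ξ)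
    {p : ℝ} (hp0 : 0 ≤ p) (hp2 : p ≤ 2)
    (hVp : ∫⁻ t in {t : ℝ | 1 ≤ |t|}, ENNReal.ofReal (|t| ^ p) ∂V < ∞) :
    ∫⁻ t, ENNReal.ofReal (|t| ^ p) ∂P < ∞ := by
  have := hP.isProbabilityMeasure
  rcases hp0.eq_or_lt with rfl | hp
  · simp
  have : IsProbabilityMeasure (P.map fun t => -t) :=
    Measure.isProbabilityMeasure_map (by fun_prop)
  refine lintegral_rpow_lt_top_of_conv_neg hp0
    (lintegral_rpow_lt_top_of_lintegral_one_sub_cos_le hp hp2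
      hf.isLevyMeasure.lintegral_sq_lt_top hVp
      (A := ENNReal.ofReal (2 * τ) * ENNReal.ofReal (v / 2)) (B := ENNReal.ofReal (2 * τ))
      (ENNReal.mul_ne_top ENNReal.ofReal_ne_top ENNReal.ofReal_ne_top) ENNReal.ofReal_ne_top
      fun ξ => ?_)
  have hneg := charFun_map_mul (μ := P) (-1) ξ
  simp only [neg_mul, one_mul] at hneg
  have hQ : (charFun (P ∗ P.map fun t => -t) ξ).re = Real.exp (2 * τ * (f ξ).re) := by
    rw [charFun_conv, hneg, charFun_neg, Complex.mul_conj, Complex.ofReal_re,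
      Complex.normSq_eq_norm_sq, hP.charFun_eq, Complex.norm_exp, Complex.re_ofReal_mul,
      ← Real.exp_nat_mul]
    push_cast
    ring_nf
  rw [lintegral_one_sub_cos_eq, hQ, mul_assoc (ENNReal.ofReal _), ← mul_add]
  calc ENNReal.ofReal (1 - Real.exp (2 * τ * (f ξ).re))
      ≤ ENNReal.ofReal (2 * τ * -(f ξ).re) := by
        refine ENNReal.ofReal_le_ofReal ?_
        linarith [Real.add_one_le_exp (2 * τ * (f ξ).re)]
    _ = ENNReal.ofReal (2 * τ) * ENNReal.ofReal (-(levyKhintchine μ v V ξ).re) := by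
        rw [ENNReal.ofReal_mul (by positivity), hf.eq_levyKhintchine]
    _ ≤ _ := by
        gcongr
        exact ofReal_neg_re_levyKhintchine_le μ v V ξ

/-! ### Witnesses -/

theorem TripletWitness.jumpMeasure {pmin pmax p q : ℝ} (h0 : 0 ≤ pmin) (h2 : pmax ≤ 2)
    {f : ℝ → ℂ} {μ : ℝ} {v : ℝ≥0} {V P : Measure ℝ} (hf : HasLevyTriplet f μ v V)
    (hw : TripletWitness pmin pmax p q μ v V) (r : ℝ) {τ : ℝ} (hτ : 0 ≤ τ)
    (hP : HasLevyExponent P fun ξ => τ * f ξ) :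
    TripletWitness pmin pmax p q (r * ∫ t in {t : ℝ | |t| ≤ 1}, t ∂P) 0 (jumpMeasure r P) := by
  have := hP.isProbabilityMeasure
  have hp0 : 0 ≤ p := h0.trans hw.pmin_le
  refine ⟨hw.pmin_le, hw.le, hw.le_pmax, ?_, ?_, fun h => hw.asymmetric ?_, by simp⟩
  · have hP' := hf.lintegral_rpow_lt_top hτ hP hp0 ((hw.le.trans hw.le_pmax).trans h2)
      hw.large_jumps
    refine (setLIntegral_le_lintegral _ _).trans_lt ?_
    rw [LevyExponents.jumpMeasure, lintegral_smul_measure]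
    exact ENNReal.mul_lt_top ENNReal.ofReal_lt_top
      ((setLIntegral_le_lintegral _ _).trans_lt hP')
  · calc ∫⁻ t in {t : ℝ | |t| < 1}, ENNReal.ofReal (|t| ^ q) ∂LevyExponents.jumpMeasure r P
        ≤ ∫⁻ _ in {t : ℝ | |t| < 1}, 1 ∂LevyExponents.jumpMeasure r P := by
          refine setLIntegral_mono (by fun_prop) fun t ht => ?_
          rw [← ENNReal.ofReal_one]
          exact ENNReal.ofReal_le_ofReal
            (Real.rpow_le_one (abs_nonneg _) (le_of_lt ht) (hp0.trans hw.le))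
      _ < ∞ := by simp
  · by_contra hc
    push Not at hc
    obtain ⟨hV, rfl⟩ := hc
    have hsym : IsSymmetric P := isSymmetric_of_charFun_neg fun ξ => by
      rw [hP.charFun_eq, hP.charFun_eq, hf.eq_levyKhintchine, hf.eq_levyKhintchine,
        levyKhintchine_neg hV]
    rcases h with h | h
    · exact h (hsym.jumpMeasure r)
    · exact h (by rw [hsym.setIntegral_id_eq_zero, mul_zero])

end LevyExponents

theorem mainTheorem3 (pmin pmax : ℝ) (h0 : 0 ≤ pmin) (h1 : pmin ≤ pmax) (h2 : pmax ≤ 2)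
    (f : ℝ → ℂ) (hf : LevyExponents.IsExponent pmin pmax f)
    (r τ : ℝ) (hr : 0 < r) (hτ : 0 < τ) :
    LevyExponents.IsExponent pmin pmax (LevyExponents.poissonExponent r τ f) ∧
    ∃ P : Measure ℝ,
      LevyExponents.HasLevyExponent P (fun ξ => τ * f ξ) ∧
      LevyExponents.HasLevyExponent (LevyExponents.compoundPoissonLaw r P)
        (LevyExponents.poissonExponent r τ f) ∧
      LevyExponents.HasLevyTriplet (LevyExponents.poissonExponent r τ f)
        (r * ∫ t in {t : ℝ | |t| ≤ 1}, t ∂P) 0 (LevyExponents.jumpMeasure r P) ∧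
      ∀ (μ : ℝ) (v : ℝ≥0) (V : Measure ℝ) (p q : ℝ),
        LevyExponents.HasLevyTriplet f μ v V →
        LevyExponents.TripletWitness pmin pmax p q μ v V →
        LevyExponents.TripletWitness pmin pmax p q
          (r * ∫ t in {t : ℝ | |t| ≤ 1}, t ∂P) 0 (LevyExponents.jumpMeasure r P) := by
  obtain ⟨μ, v, V, hV, p, q, hw⟩ := hf
  obtain ⟨P, hP⟩ := hV.isLevyExponent.exists_hasLevyExponent_mul hτ.le
  have ht := hP.hasLevyTriplet_poissonExponent hr.le
  exact ⟨⟨_, _, _, ht, p, q, hw.jumpMeasure h0 h2 hV r hτ.le hP⟩, P, hP,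
    hP.compoundPoissonLaw hr.le, ht, fun μ v V p q hV hw => hw.jumpMeasure h0 h2 hV r hτ.le hP⟩
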